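/- Let $R$ be a ring with $1$ and $M$ an $R$-module that is both Noetherian and Artinian. A constituent of $M$ is a subquotient $A/B$ with $B\subseteq A\subseteq M$ submodules, taken as placed inside $M$ (not up to isomorphism). Let $T/N$ be a subquotient and $F$ a submodule of $M$: we say that $T/N$ lies in $F$ if $T=N+(T\cap F)$, and that it lies over $F$ if $T\cap F\subseteq N$. A quotient $T/P$ with $P\subseteq N\subseteq T$ splits over $N$ if $N+K=T$, $N\cap K=P$ for some submodule $K$. Diagrams. Let $D$ be a finite directed graph without loops, multiple edges or directed cycles, whose edges are thought of as pointing down. A set $U$ of vertices is open if every edge starting in $U$ ends in $U$. Write $\downarrow x$ for the set of vertices reachable from $x$ by directed paths ($x$ included) and $\uparrow y$ for the set of vertices from which $y$ is reachable. A diagram of the constituent $A/B$ is such a graph $D$ with a submodule $G(U)$, $B\subseteq G(U)\subseteq A$, for every open $U$, such that: (a) $G(\emptyset)=B$, $G(D)=A$, $G(U\cup W)=G(U)+G(W)$, $G(U\cap W)=G(U)\cap G(W)$, and $G(U\cup\{x\})/G(U)$ is simple whenever $x\notin U$ and $U$, $U\cup\{x\}$ are open (this is the simple constituent at $x$); (b)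 downward fans are not cleaved by submodules: if $W_1\subsetneq W_2\subsetneq{\downarrow}x$ are open, then $G({\downarrow}x)/G(W_1)$ does not split over $G(W_2)$; upward fans are not cleaved by quotients: if $D\setminus{\uparrow}y\subsetneq W_1\subsetneq W_2$ are open, then $G(W_2)/G(D\setminus{\uparrow}y)$ does not split over $G(W_1)$; (c) every edge $x\to y$ represents a non-split extension: there are submodules $B\subseteq P\subseteq N\subseteq T\subseteq A$ such that $N/P$ is placed at $y$, $T/N$ is placed at $x$, and $T/P$ does not split over $N$. Here a simple constituent is placed at the vertex $x$ if, for every open $U$, it lies in $G(U)$ when $x\in U$ and lies over $G(U)$ when $x\notin U$. A virtual diagram $\mathfrak D$ of $M$ is a diagram of $M=M/0$, with submodules $F(U)$, that is satiated: it is not a proper subgraph of another diagram of $M$ in which the constituents at its vertices are placed at the same vertices. A subdiagram of $\mathfrak D$ is the full subgraph on a set $D$ of vertices. It is realizable if it corresponds to some constituent $A/B$ of $M$, i.e. if $D$ is a diagram of $A/B$ for some submodules $G(U)$ such that, for each $x\in D$, the simple constituents $G(U\cup\{x\})/G(U)$ are placed at $x$ in $\mathfrak D$. The vertex $x$ is in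 the radical layer $i$ if its constituent $F({\downarrow}x)/F({\downarrow}x\setminus\{x\})$ lies in $\operatorname{rad}^iM$ and over $\operatorname{rad}^{i+1}M$. A generalized monotone path from $x$ to $y$ is a sequence $K_0=\{x\},K_1,\dots,K_m=\{y\}$ of realizable sets of vertices (generalized vertices, which may represent non-simple constituents), with $a_i,b_i\in K_i$ such that $b_i$ is reachable from $a_i$ by a directed path in $K_i$ and there is an edge $b_i\to a_{i+1}$ for each $i<m$. Proposition. Let $\mathfrak D$ be a virtual diagram of $M$ and $D$ a connected (non-empty) subdiagram of it. Then $D$ is realizable if and only if there is no generalized monotone path that joins two vertices of $D$ in different radical layers and has a generalized vertex $K_i$ outside $D$ (i.e. $K_i\cap D=\emptyset$). -/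

import Mathlib

/-!
Conventions.  `R` is a ring, `M` an `R`-module, `V` the vertex set of an oriented graph with edge
relation `e` (`e x y` : there is an edge going down from `x` to `y`).

A constituent `A / B` of `M` (a submodule of a subquotient of `M`, placed inside `M` and not taken
up to isomorphism) is written as the pair of submodules `B ≤ A` of `M`.  Submodules of `A / B` are
the submodules of `M` between `B` and `A`.
-/

namespace VirtualDiagrams

universe u v w

section Graph

variable {V : Type w}

/-- The edges of the subdiagram with vertex set `D`: an edge belongs to it iff both its ends do. -/
def EdgeIn (e : V → V → Prop) (D : Set V) (x y : V) : Prop :=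
  x ∈ D ∧ y ∈ D ∧ e x y

/-- `U` is an open subdiagram of `D`: it is closed under going down along edges of `D`. -/
def IsOpenIn (e : V → V → Prop) (D U : Set V) : Prop :=
  U ⊆ D ∧ ∀ x y, EdgeIn e D x y → x ∈ U → y ∈ U

/-- The vertices of `D` reached from `x` by going down inside `D` (`x` included). -/
def below (e : V → V → Prop) (D : Set V) (x : V) : Set V :=
  {z | Relation.ReflTransGen (EdgeIn e D) x z}

/-- The vertices of `D` reached from `x` by going down at least one edge of `D`. -/
def strictBelow (e : V → V → Prop) (D : Set V) (x : V) : Set V :=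
  {z | Relation.TransGen (EdgeIn e D) x z}

/-- The vertices of `D` from which one cannot reach `y` by going down inside `D`. -/
def notAbove (e : V → V → Prop) (D : Set V) (y : V) : Set V :=
  {z | z ∈ D ∧ ¬ Relation.ReflTransGen (EdgeIn e D) z y}

/-- The subdiagram of `e` with vertex set `D` is connected (in particular non-empty). -/
def IsConnectedSubdiagram (e : V → V → Prop) (D : Set V) : Prop :=
  ((SimpleGraph.fromRel e).induce D).Connected

end Graph

section Diagram

variable {R : Type u} [Ring R] {M : Type v} [AddCommGroup M] [Module R M] {V : Type w}

/-- The extension `T / P` of `T / N` by `N / P` splits. -/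
def Splits (P N T : Submodule R M) : Prop :=
  ∃ K : Submodule R M, N ⊔ K = T ∧ N ⊓ K = P

/-- Let `G` attach a submodule of `M` to every open subdiagram of `D`.  The simple constituent
`T / N` is placed at the vertex `x` of `D` if, for every open `U`,
* when `x ∈ U`, it is a constituent of the submodule `G U`, by the identification
  `T / N = (N + (T ∩ G U)) / N = (T ∩ G U) / (N ∩ G U)`;
* when `x ∉ U`, it is a constituent of the quotient modulo `G U`, by the identification
  `T / N = T / (T ∩ (N + G U)) = (T + G U) / (N + G U)`. -/
def PlacedAt (e : V → V → Prop) (D : Set V) (G : Set V → Submodule R M)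
    (N T : Submodule R M) (x : V) : Prop :=
  N ⋖ T ∧ ∀ U, IsOpenIn e D U →
    (x ∈ U → T ≤ N ⊔ (T ⊓ G U)) ∧ (x ∉ U → T ⊓ G U ≤ N)

/-- The graph `e` on the vertex set `D` is a diagram of the constituent `A / B`, its open
subdiagrams `U` being realized by the submodules `G U / B` of `A / B` and their (closed)
complements by the quotients `A / G U`.  Only the values of `G` on open subdiagrams matter. -/
structure IsDiagramOf (e : V → V → Prop) (D : Set V) (B A : Submodule R M)
    (G : Set V → Submodule R M) : Prop where
  /-- the graph is directed downwards -/
  acyclic : ∀ x, ¬ Relation.TransGen (EdgeIn e D) x x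
  bot : G ∅ = B
  top : G D = A
  sup : ∀ U W, IsOpenIn e D U → IsOpenIn e D W → G (U ∪ W) = G U ⊔ G W
  inf : ∀ U W, IsOpenIn e D U → IsOpenIn e D W → G (U ∩ W) = G U ⊓ G W
  /-- the vertices are simple constituents -/
  simple : ∀ U x, IsOpenIn e D U → IsOpenIn e D (insert x U) → x ∉ U → G U ⋖ G (insert x U)
  /-- Taking submodules does not cleave a downward fan: in the generalized fan with head node `x`
  and vertex set `below x \ W₁`, the proper subfan `below x \ W₂` (which still contains `x`, and
  which is the quotient `G (below x) / G W₂`) is not a submodule. -/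
  downward_fan : ∀ x ∈ D, ∀ W₁ W₂, IsOpenIn e D W₁ → IsOpenIn e D W₂ → W₁ ⊂ W₂ →
    W₂ ⊂ below e D x → ¬ Splits (G W₁) (G W₂) (G (below e D x))
  /-- Taking quotients does not cleave an upward fan: in the generalized fan with basis node `y`
  and vertex set `W₂ \ notAbove y`, the proper subfan `W₁ \ notAbove y` (which still contains `y`,
  and which is the submodule `G W₁ / G (notAbove y)`) is not a quotient. -/
  upward_fan : ∀ y ∈ D, ∀ W₁ W₂, IsOpenIn e D W₁ → IsOpenIn e D W₂ → notAbove e D y ⊂ W₁ →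
    W₁ ⊂ W₂ → ¬ Splits (G (notAbove e D y)) (G W₁) (G W₂)
  /-- every edge represents a non-split extension inside `A / B` -/
  edge : ∀ x y, EdgeIn e D x y → ∃ P N T : Submodule R M, B ≤ P ∧ T ≤ A ∧
    PlacedAt e D G P N y ∧ PlacedAt e D G N T x ∧ ¬ Splits P N T

/-- The diagram given by `e`, `F` on `V` is a proper subdiagram (proper subgraph with the same
virtual correspondence of its vertices) of the diagram given by `e'`, `F'` on `V'`. -/
def IsProperSubdiagramOf {V' : Type w} (e : V → V → Prop) (F : Set V → Submodule R M)
    (e' : V' → V' → Prop) (F' : Set V' → Submodule R M) : Prop :=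
  ∃ φ : V ↪ V', (∀ x y, e x y → e' (φ x) (φ y)) ∧
    (∀ x, PlacedAt e' Set.univ F' (F (strictBelow e Set.univ x)) (F (below e Set.univ x)) (φ x)) ∧
    ((∃ z, z ∉ Set.range φ) ∨ ∃ x y, e' (φ x) (φ y) ∧ ¬ e x y)

variable (R M V) in
/-- A virtual diagram of the module `M` with vertex set `V`. -/
structure VirtualDiagram where
  /-- `edge x y` : an edge going down from `x` to `y` -/
  edge : V → V → Prop
  /-- the submodules of `M` realizing the open subdiagrams -/
  sub : Set V → Submodule R M
  isDiagram : IsDiagramOf edge Set.univ ⊥ ⊤ sub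
  satiety : ¬ ∃ (V' : Type w) (e' : V' → V' → Prop) (F' : Set V' → Submodule R M),
    Finite V' ∧ IsDiagramOf e' Set.univ ⊥ ⊤ F' ∧ IsProperSubdiagramOf edge sub e' F'

variable (R M) in
/-- The radical powers `rad^i M`; `rad^(i+1) M` is the radical of the module `rad^i M`. -/
noncomputable def radPow : ℕ → Submodule R M
  | 0 => ⊤
  | i + 1 => (Module.jacobson R (radPow i)).map (radPow i).subtype

namespace VirtualDiagram

variable (𝔇 : VirtualDiagram R M V)

/-- The simple constituent of `M` at the vertex `x` belongs to the layer
`rad^i M / rad^(i+1) M` (so `i = 0` is the head of `M`). -/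
def InRadicalLayer (x : V) (i : ℕ) : Prop :=
  let T := 𝔇.sub (below 𝔇.edge Set.univ x)
  let N := 𝔇.sub (strictBelow 𝔇.edge Set.univ x)
  T ≤ N ⊔ (T ⊓ radPow R M i) ∧ T ⊓ radPow R M (i + 1) ≤ N

/-- The vertices `x` and `y` are in different radical layers. -/
def InDifferentLayers (x y : V) : Prop :=
  ∃ i j, 𝔇.InRadicalLayer x i ∧ 𝔇.InRadicalLayer y j ∧ i ≠ j

/-- The constituent `A / B` of `M` corresponds to the subdiagram `D`: with the same virtual
correspondence of its vertices, `D` is a diagram of `A / B`. -/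
def Realizes (B A : Submodule R M) (D : Set V) : Prop :=
  ∃ G : Set V → Submodule R M, IsDiagramOf 𝔇.edge D B A G ∧
    ∀ U x, IsOpenIn 𝔇.edge D U → IsOpenIn 𝔇.edge D (insert x U) → x ∉ U →
      PlacedAt 𝔇.edge Set.univ 𝔇.sub (G U) (G (insert x U)) x

/-- The subdiagram `D` corresponds to some constituent of `M`. -/
def Realizable (D : Set V) : Prop :=
  ∃ B A : Submodule R M, B ≤ A ∧ 𝔇.Realizes B A D

/-- `K 0, …, K m` is a generalized monotone path from the vertex `x` down to the vertex `y`: its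
(generalized) vertices are sets of vertices that represent not necessarily simple constituents,
and the path enters `K i` at `a i`, goes down to `b i` in `K i`, and leaves along an edge from
`b i` down to `a (i+1)`. -/
def IsGeneralizedPath (x y : V) (m : ℕ) (K : Fin (m + 1) → Set V) : Prop :=
  K 0 = {x} ∧ K (Fin.last m) = {y} ∧ (∀ i, 𝔇.Realizable (K i)) ∧
    ∃ a b : Fin (m + 1) → V,
      (∀ i, a i ∈ K i ∧ b i ∈ K i ∧ Relation.ReflTransGen (EdgeIn 𝔇.edge (K i)) (a i) (b i)) ∧
      ∀ i : Fin m, 𝔇.edge (b i.castSucc) (a i.succ)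

end VirtualDiagram

end Diagram

end VirtualDiagrams

/-!
Realizable sets of vertices are the convex ones, i.e. those which contain every vertex lying on a
directed path between two of their vertices; the theorem then only has to compare convexity with
generalized paths.

By the fan conditions the submodule generated by a vertex is local and the quotient cogenerated by
a vertex is colocal, hence every constituent `T / N` placed at `x` satisfies `F (↓x) ≤ T` and
`N ≤ F (V \ ↑x)`. If `A / B` realizes `D` and `z ∉ D` lies between two vertices of `D`, this gives
`F (↓z) ≤ A` and `B ≤ F (V \ ↑y)` for some `y ∈ D` below `z`. Moreover `D` has the same open sets
`D ∩ ↓z` and `D ∩ (↓z \ {z})`, so `F (↓z) ≤ F (↓z \ {z}) + B`, thus `F (↓z) ≤ B` by locality, which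
contradicts `y ∈ ↓z`. Conversely, a convex `D` is the difference of the open sets `↓D` and `↓D \ D`
and is realized by the corresponding constituent `F (↓D) / F (↓D \ D)`.

Along a directed path the radical layers strictly increase, since a proper submodule of a local
submodule of `rad^i M` lies in `rad^(i+1) M`. So a vertex outside `D` on a directed path between
vertices of `D` is a generalized vertex of the kind that the theorem forbids.
-/

namespace VirtualDiagrams

universe u v w

section Graph

variable {V : Type w} {e : V → V → Prop} {D U W : Set V} {x y z : V}

theorem isOpenIn_empty : IsOpenIn e D ∅ := ⟨Set.empty_subset _, fun _ _ _ h => h.elim⟩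

theorem isOpenIn_self : IsOpenIn e D D := ⟨subset_rfl, fun _ _ h _ => h.2.1⟩

theorem IsOpenIn.union (hU : IsOpenIn e D U) (hW : IsOpenIn e D W) : IsOpenIn e D (U ∪ W) :=
  ⟨Set.union_subset hU.1 hW.1, fun x y h hx => hx.imp (hU.2 x y h) (hW.2 x y h)⟩

theorem IsOpenIn.inter (hU : IsOpenIn e D U) (hW : IsOpenIn e D W) : IsOpenIn e D (U ∩ W) :=
  ⟨fun _ h => hU.1 h.1, fun x y h hx => ⟨hU.2 x y h hx.1, hW.2 x y h hx.2⟩⟩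

theorem IsOpenIn.inter_of_univ (D : Set V) (hU : IsOpenIn e Set.univ U) : IsOpenIn e D (D ∩ U) :=
  ⟨Set.inter_subset_left, fun x y h hx => ⟨h.2.1, hU.2 x y ⟨trivial, trivial, h.2.2⟩ hx.2⟩⟩

theorem IsOpenIn.compl (hU : IsOpenIn e D U) : IsOpenIn (flip e) D (D \ U) :=
  ⟨Set.sdiff_subset, fun x y h hx => ⟨h.2.1, fun hy => hx.2 (hU.2 y x ⟨h.2.1, h.1, h.2.2⟩ hy)⟩⟩

theorem edgeIn_flip : EdgeIn (flip e) D = flip (EdgeIn e D) := by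
  ext x y
  exact and_left_comm

theorem mem_below (x : V) : x ∈ below e D x := Relation.ReflTransGen.refl

theorem IsOpenIn.below_subset (hU : IsOpenIn e D U) (hx : x ∈ U) : below e D x ⊆ U := by
  intro z hz
  induction hz with
  | refl => exact hx
  | tail _ h ih => exact hU.2 _ _ h ih

theorem isOpenIn_below (hx : x ∈ D) : IsOpenIn e D (below e D x) :=
  ⟨isOpenIn_self.below_subset hx, fun _ _ h hz => Relation.ReflTransGen.tail hz h⟩

theorem isOpenIn_strictBelow (x : V) : IsOpenIn e D (strictBelow e D x) :=
  ⟨fun _ h => by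
      obtain ⟨_, _, h⟩ := Relation.TransGen.tail'_iff.1 h
      exact h.2.1,
    fun _ _ h hz => Relation.TransGen.tail hz h⟩

theorem insert_strictBelow (x : V) : insert x (strictBelow e D x) = below e D x := by
  ext z
  exact Relation.reflTransGen_iff_eq_or_transGen.symm

theorem strictBelow_subset_below (x : V) : strictBelow e D x ⊆ below e D x :=
  fun _ h => Relation.TransGen.to_reflTransGen h

theorem mem_strictBelow_of_mem_below (hz : z ∈ below e D x) (hne : z ≠ x) :
    z ∈ strictBelow e D x :=
  (Relation.reflTransGen_iff_eq_or_transGen.1 hz).resolve_left hne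

theorem IsOpenIn.subset_strictBelow (hW : IsOpenIn e D W) (h : W ⊂ below e D x) :
    W ⊆ strictBelow e D x :=
  fun _ hz => mem_strictBelow_of_mem_below (h.1 hz) fun hzx => h.2 (hW.below_subset (hzx ▸ hz))

theorem isOpenIn_notAbove (y : V) : IsOpenIn e D (notAbove e D y) :=
  ⟨fun _ h => h.1, fun _ _ h hx => ⟨h.2.1, fun h' => hx.2 (h'.head h)⟩⟩

theorem notMem_notAbove (y : V) : y ∉ notAbove e D y := fun h => h.2 Relation.ReflTransGen.refl

theorem isOpenIn_insert_notAbove (hac : ∀ x, ¬ Relation.TransGen (EdgeIn e D) x x) (hy : y ∈ D) :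
    IsOpenIn e D (insert y (notAbove e D y)) := by
  refine ⟨Set.insert_subset hy (isOpenIn_notAbove y).1, ?_⟩
  rintro x z h (rfl | hx)
  · exact Or.inr ⟨h.2.1, fun h' => hac _ (Relation.TransGen.head' h h')⟩
  · exact Or.inr ((isOpenIn_notAbove y).2 _ _ h hx)

theorem IsOpenIn.subset_notAbove (hU : IsOpenIn e D U) (hy : y ∉ U) : U ⊆ notAbove e D y :=
  fun _ h => ⟨hU.1 h, fun h' => hy (hU.below_subset h h')⟩

theorem IsOpenIn.mem_of_notAbove_ssubset (hU : IsOpenIn e D U) (h : notAbove e D y ⊂ U) : y ∈ U :=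
  by_contra fun hy => h.2 (hU.subset_notAbove hy)

theorem below_subset_below_univ (x : V) : below e D x ⊆ below e Set.univ x :=
  fun _ => Relation.ReflTransGen.mono (fun _ _ h => ⟨trivial, trivial, h.2.2⟩) _ _

theorem strictBelow_subset_strictBelow_univ (x : V) :
    strictBelow e D x ⊆ strictBelow e Set.univ x :=
  fun _ => Relation.TransGen.mono (fun _ _ h => ⟨trivial, trivial, h.2.2⟩) _ _

theorem IsOpenIn.exists_sdiff_singleton [Finite V]
    (hac : ∀ x, ¬ Relation.TransGen (EdgeIn e D) x x) (hU : IsOpenIn e D U) (hne : U.Nonempty) :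
    ∃ x ∈ U, IsOpenIn e D (U \ {x}) := by
  have : Std.Irrefl (Relation.TransGen (EdgeIn e D)) := ⟨hac⟩
  obtain ⟨x, hx, hmax⟩ :=
    (Finite.wellFounded_of_trans_of_irrefl (Relation.TransGen (EdgeIn e D))).has_min U hne
  refine ⟨x, hx, Set.sdiff_subset.trans hU.1, fun a b hab ha => ⟨hU.2 a b hab ha.1, ?_⟩⟩
  rintro rfl
  exact hmax a ha.1 (Relation.TransGen.single hab)

@[elab_as_elim]
theorem IsOpenIn.induction_insert [Finite V] (hac : ∀ x, ¬ Relation.TransGen (EdgeIn e D) x x)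
    {motive : Set V → Prop} (empty : motive ∅)
    (insert : ∀ U x, IsOpenIn e D U → IsOpenIn e D (insert x U) → x ∉ U → motive U →
      motive (insert x U))
    (hU : IsOpenIn e D U) : motive U := by
  induction U using WellFoundedLT.induction with
  | ind U ih =>
    rcases U.eq_empty_or_nonempty with rfl | hne
    · exact empty
    · obtain ⟨x, hx, hUx⟩ := hU.exists_sdiff_singleton hac hne
      have hins : Insert.insert x (U \ {x}) = U := Set.insert_sdiff_self_of_mem hx
      rw [← hins]
      exact insert _ x hUx (hins.symm ▸ hU) (fun h => h.2 rfl)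
        (ih _ (Set.sdiff_singleton_ssubset.2 hx) hUx)

@[elab_as_elim]
theorem IsOpenIn.induction_erase [Finite V] (hac : ∀ x, ¬ Relation.TransGen (EdgeIn e D) x x)
    {motive : Set V → Prop} (self : motive D)
    (erase : ∀ U x, IsOpenIn e D U → IsOpenIn e D (insert x U) → x ∉ U → motive (insert x U) →
      motive U)
    (hU : IsOpenIn e D U) : motive U := by
  have hac' (x : V) : ¬ Relation.TransGen (EdgeIn (flip e) D) x x := by
    rw [edgeIn_flip]
    exact fun h => hac x (Relation.transGen_swap.1 h)
  have key : motive (D \ (D \ U)) := by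
    refine hU.compl.induction_insert (motive := fun W => motive (D \ W)) hac' ?_ ?_
    · rwa [Set.sdiff_empty]
    · intro W x hW hxW hx ih
      have hxD : x ∈ D := hxW.1 (Set.mem_insert x W)
      have hins : insert x (D \ insert x W) = D \ W := by grind
      exact erase _ x hxW.compl (hins ▸ hW.compl) (fun h => h.2 (Set.mem_insert x W)) (hins ▸ ih)
  rwa [Set.sdiff_sdiff_cancel_left hU.1] at key

/-- A set of vertices containing every directed path between two of its vertices. -/
def IsConvex (e : V → V → Prop) (D : Set V) : Prop :=
  ∀ ⦃x⦄, x ∈ D → ∀ ⦃y⦄, y ∈ D → ∀ ⦃z⦄, z ∈ below e Set.univ x → y ∈ below e Set.univ z → z ∈ D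

/-- The smallest open set of vertices containing `D`. -/
def lowerHull (e : V → V → Prop) (D : Set V) : Set V :=
  {z | ∃ x ∈ D, z ∈ below e Set.univ x}

/-- The largest set in the lower hull of `D` whose trace on `D` is `U`. For convex `D` it is open
whenever `U` is open in `D`, which makes the open sets of `D` correspond to the open sets between
`openExtension e D ∅` and `openExtension e D D`, the lower hull. -/
def openExtension (e : V → V → Prop) (D U : Set V) : Set V :=
  U ∪ lowerHull e D \ D

theorem subset_lowerHull : D ⊆ lowerHull e D := fun x hx => ⟨x, hx, mem_below x⟩

theorem isOpenIn_lowerHull : IsOpenIn e Set.univ (lowerHull e D) :=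
  ⟨Set.subset_univ _, fun _ _ h ⟨d, hd, h'⟩ => ⟨d, hd, h'.tail h⟩⟩

theorem mem_openExtension (hx : x ∈ D) : x ∈ openExtension e D U ↔ x ∈ U :=
  or_iff_left fun h => h.2 hx

theorem openExtension_mono (h : U ⊆ W) : openExtension e D U ⊆ openExtension e D W :=
  Set.union_subset_union_left _ h

theorem openExtension_insert (x : V) (U : Set V) :
    openExtension e D (insert x U) = insert x (openExtension e D U) :=
  Set.insert_union

theorem subset_of_openExtension_subset (hU : U ⊆ D)
    (h : openExtension e D U ⊆ openExtension e D W) : U ⊆ W :=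
  fun _ hx => (mem_openExtension (hU hx)).1 (h (Or.inl hx))

namespace IsConvex

theorem isOpenIn_openExtension (hD : IsConvex e D) (hU : IsOpenIn e D U) :
    IsOpenIn e Set.univ (openExtension e D U) := by
  refine ⟨Set.subset_univ _, fun x y h hx => ?_⟩
  by_cases hyD : y ∈ D
  · rcases hx with hx | ⟨⟨d, hd, hdx⟩, hx⟩
    · exact Or.inl (hU.2 x y ⟨hU.1 hx, hyD, h.2.2⟩ hx)
    · exact absurd (hD hd hyD hdx (Relation.ReflTransGen.single h)) hx
  · have hxH : x ∈ lowerHull e D := hx.elim (fun hx => subset_lowerHull (hU.1 hx)) And.left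
    exact Or.inr ⟨isOpenIn_lowerHull.2 x y h hxH, hyD⟩

theorem openExtension_below (hD : IsConvex e D) (hx : x ∈ D) :
    openExtension e D (below e D x) = below e Set.univ x ∪ openExtension e D ∅ := by
  refine Set.Subset.antisymm ?_ (Set.union_subset ?_ (openExtension_mono (Set.empty_subset _)))
  · exact Set.union_subset_union (below_subset_below_univ x) Set.subset_union_right
  · exact (hD.isOpenIn_openExtension (isOpenIn_below hx)).below_subset (Or.inl (mem_below x))

theorem openExtension_notAbove (hD : IsConvex e D) (hy : y ∈ D) :
    openExtension e D (notAbove e D y) = notAbove e Set.univ y ∩ openExtension e D D := by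
  have hopen := hD.isOpenIn_openExtension (isOpenIn_notAbove (e := e) (D := D) y)
  refine Set.Subset.antisymm (Set.subset_inter ?_ (openExtension_mono fun _ h => h.1)) ?_
  · exact hopen.subset_notAbove fun h => notMem_notAbove y ((mem_openExtension hy).1 h)
  · rintro z ⟨hz, hzD | hzH⟩
    · exact Or.inl ⟨hzD, fun h => hz.2 (below_subset_below_univ z h)⟩
    · exact Or.inr hzH

end IsConvex

end Graph

section Lattice

variable {α : Type u} [Lattice α]

theorem sup_eq_of_covBy_of_not_le {a b c : α} (hab : a ⋖ b) (hcb : c ≤ b) (hca : ¬ c ≤ a) :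
    a ⊔ c = b :=
  (hab.eq_or_eq le_sup_left (sup_le hab.le hcb)).resolve_left fun h => hca (sup_eq_left.1 h)

theorem inf_eq_of_covBy_of_not_le {a b c : α} (hab : a ⋖ b) (hac : a ≤ c) (hbc : ¬ b ≤ c) :
    b ⊓ c = a :=
  (hab.eq_or_eq (le_inf hab.le hac) inf_le_left).resolve_right fun h => hbc (inf_eq_left.1 h)

variable [IsModularLattice α] {N T H C Q : α}

/-- The map `X ↦ X ⊓ H ⊔ C` transports constituents that lie in `H` and over `C` to `H / C`; this is
how the constituents of a module are seen inside one of its subquotients. -/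
theorem inf_sup_covBy_inf_sup (hNT : N ⋖ T) (hH : T ≤ N ⊔ T ⊓ H) (hC : T ⊓ C ≤ N) :
    N ⊓ H ⊔ C ⋖ T ⊓ H ⊔ C := by
  have hinf : N ⊓ H ⋖ T ⊓ H := by
    have h₁ : N ⊔ T ⊓ H = T := le_antisymm (sup_le hNT.le inf_le_left) hH
    have h₂ : N ⊓ (T ⊓ H) = N ⊓ H := by rw [← inf_assoc, inf_eq_left.2 hNT.le]
    rw [← h₁] at hNT
    exact h₂ ▸ hNT.inf_of_sup_left
  have hmeet : T ⊓ H ⊓ (N ⊓ H ⊔ C) = N ⊓ H := by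
    rw [inf_comm, sup_inf_assoc_of_le _ hinf.le, sup_eq_left]
    exact le_inf (hC.trans' (le_inf (inf_le_right.trans inf_le_left) inf_le_left))
      (inf_le_right.trans inf_le_right)
  have hjoin : T ⊓ H ⊔ (N ⊓ H ⊔ C) = T ⊓ H ⊔ C := by
    rw [← sup_assoc, sup_eq_left.2 hinf.le]
  rw [← hjoin]
  exact CovBy.sup_of_inf_left (hmeet.symm ▸ hinf)

theorem inf_sup_le_of_le_sup_inf (hQH : Q ≤ H) (h : T ≤ N ⊔ T ⊓ Q) :
    T ⊓ H ⊔ C ≤ N ⊓ H ⊔ C ⊔ (T ⊓ H ⊔ C) ⊓ Q := by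
  refine sup_le ?_ (le_sup_right.trans le_sup_left)
  calc T ⊓ H ≤ (T ⊓ Q ⊔ N) ⊓ H := inf_le_inf_right _ (h.trans (sup_comm _ _).le)
    _ = T ⊓ Q ⊔ N ⊓ H := sup_inf_assoc_of_le _ (inf_le_right.trans hQH)
    _ ≤ (T ⊓ H ⊔ C) ⊓ Q ⊔ (N ⊓ H ⊔ C) :=
      sup_le_sup (le_inf ((inf_le_inf_left _ hQH).trans le_sup_left) inf_le_right) le_sup_left
    _ = N ⊓ H ⊔ C ⊔ (T ⊓ H ⊔ C) ⊓ Q := sup_comm _ _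

theorem inf_sup_inf_le_of_inf_le (hCQ : C ≤ Q) (h : T ⊓ Q ≤ N) :
    (T ⊓ H ⊔ C) ⊓ Q ≤ N ⊓ H ⊔ C := by
  calc (T ⊓ H ⊔ C) ⊓ Q = C ⊔ T ⊓ H ⊓ Q := by rw [sup_comm, sup_inf_assoc_of_le _ hCQ]
    _ = C ⊔ T ⊓ Q ⊓ H := by rw [inf_right_comm]
    _ ≤ C ⊔ N ⊓ H := sup_le_sup_left (inf_le_inf_right _ h) _
    _ = N ⊓ H ⊔ C := sup_comm _ _

end Lattice

section Splits

variable {R : Type u} [Ring R] {M : Type v} [AddCommGroup M] [Module R M]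
variable {P N T H C L : Submodule R M}

theorem splits_sup_of_covBy (hPN : P ⋖ N) (hL : N ⊔ L = T) (hNL : ¬ N ≤ P ⊔ L) : Splits P N T :=
  ⟨P ⊔ L, by rw [← sup_assoc, sup_eq_left.2 hPN.le, hL],
    inf_eq_of_covBy_of_not_le hPN le_sup_left hNL⟩

theorem splits_inf_of_covBy (hNT : N ⋖ T) (hL : N ⊓ L = P) (hTL : ¬ T ⊓ L ≤ N) : Splits P N T :=
  ⟨T ⊓ L, sup_eq_of_covBy_of_not_le hNT inf_le_left hTL,
    by rw [← inf_assoc, inf_eq_left.2 hNT.le, hL]⟩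

theorem Splits.of_inf_sup (hPN : P ≤ N) (hNT : N ≤ T) (hCH : C ≤ H) (hT : T ≤ N ⊔ T ⊓ H)
    (hN : N ⊓ C ≤ P) (hs : Splits (P ⊓ H ⊔ C) (N ⊓ H ⊔ C) (T ⊓ H ⊔ C)) : Splits P N T := by
  obtain ⟨K, hK₁, hK₂⟩ := hs
  have hCK : C ≤ K := (le_sup_right.trans hK₂.ge).trans inf_le_right
  have hKH : K ≤ H := (le_sup_right.trans hK₁.le).trans (sup_le inf_le_right hCH)
  have hTH : T ⊓ H ≤ N ⊔ K ⊓ T :=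
    calc T ⊓ H ≤ (N ⊓ H ⊔ K) ⊓ T := by
          refine le_inf ((le_sup_left.trans hK₁.ge).trans ?_) inf_le_left
          exact sup_le (sup_le_sup_left hCK _) le_sup_right
      _ = N ⊓ H ⊔ K ⊓ T := sup_inf_assoc_of_le _ (inf_le_left.trans hNT)
      _ ≤ N ⊔ K ⊓ T := sup_le_sup_right inf_le_left _
  have hKN : K ⊓ N ≤ P :=
    calc K ⊓ N ≤ (P ⊓ H ⊔ C) ⊓ N := by
          rw [← hK₂]
          refine le_inf (le_inf (le_sup_of_le_left ?_) inf_le_left) inf_le_right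
          exact le_inf inf_le_right (inf_le_left.trans hKH)
      _ = P ⊓ H ⊔ C ⊓ N := sup_inf_assoc_of_le _ (inf_le_left.trans hPN)
      _ ≤ P := sup_le inf_le_left (inf_comm C N ▸ hN)
  refine ⟨P ⊔ K ⊓ T, le_antisymm ?_ (hT.trans (sup_le le_sup_left ?_)), ?_⟩
  · exact sup_le hNT (sup_le (hPN.trans hNT) inf_le_right)
  · exact hTH.trans (sup_le_sup_left le_sup_right _)
  · rw [inf_comm, sup_inf_assoc_of_le _ hPN, inf_assoc, inf_eq_right.2 hNT, sup_eq_left]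
    exact hKN

end Splits

section Diagram

variable {R : Type u} [Ring R] {M : Type v} [AddCommGroup M] [Module R M] {V : Type w}
variable {e : V → V → Prop} {D U W : Set V} {A B N T Q : Submodule R M} {G : Set V → Submodule R M}
variable {x y z : V}

namespace IsDiagramOf

theorem mono (h : IsDiagramOf e D B A G) (hU : IsOpenIn e D U) (hW : IsOpenIn e D W)
    (hUW : U ⊆ W) : G U ≤ G W := by
  rw [← Set.union_eq_self_of_subset_left hUW, h.sup U W hU hW]
  exact le_sup_left

theorem lower_le (h : IsDiagramOf e D B A G) (hU : IsOpenIn e D U) : B ≤ G U :=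
  h.bot ▸ h.mono isOpenIn_empty hU (Set.empty_subset _)

theorem le_upper (h : IsDiagramOf e D B A G) (hU : IsOpenIn e D U) : G U ≤ A :=
  h.top ▸ h.mono hU isOpenIn_self hU.1

theorem strictBelow_covBy (h : IsDiagramOf e D B A G) (hx : x ∈ D) :
    G (strictBelow e D x) ⋖ G (below e D x) := by
  rw [← insert_strictBelow]
  refine h.simple _ x (isOpenIn_strictBelow x) ?_ (h.acyclic x)
  rw [insert_strictBelow]
  exact isOpenIn_below hx

theorem notAbove_covBy (h : IsDiagramOf e D B A G) (hy : y ∈ D) :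
    G (notAbove e D y) ⋖ G (insert y (notAbove e D y)) :=
  h.simple _ y (isOpenIn_notAbove y) (isOpenIn_insert_notAbove h.acyclic hy) (notMem_notAbove y)

theorem subset_of_le (h : IsDiagramOf e D B A G) (hU : IsOpenIn e D U) (hW : IsOpenIn e D W)
    (hle : G U ≤ G W) : U ⊆ W := by
  intro z hz
  by_contra hzW
  have hzo : IsOpenIn e D (below e D z) := isOpenIn_below (hU.1 hz)
  have hsub : below e D z ∩ W ⊆ strictBelow e D z := fun v hv =>
    mem_strictBelow_of_mem_below hv.1 fun hvz => hzW (hvz ▸ hv.2)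
  refine (h.strictBelow_covBy (hU.1 hz)).lt.not_ge ?_
  calc G (below e D z) ≤ G (below e D z) ⊓ G W :=
        le_inf le_rfl ((h.mono hzo hU (hU.below_subset hz)).trans hle)
    _ = G (below e D z ∩ W) := (h.inf _ _ hzo hW).symm
    _ ≤ G (strictBelow e D z) := h.mono (hzo.inter hW) (isOpenIn_strictBelow z) hsub

theorem below_le_of_le_sup [Finite V] (h : IsDiagramOf e D B A G) (hx : x ∈ D) (hB : B ≤ Q)
    (hQ : G (below e D x) ≤ G (strictBelow e D x) ⊔ Q) : G (below e D x) ≤ Q := by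
  suffices key : ∀ U, IsOpenIn e D U → U ⊆ strictBelow e D x → G (below e D x) ≤ G U ⊔ Q →
      G (below e D x) ≤ Q from key _ (isOpenIn_strictBelow x) subset_rfl hQ
  intro U hU
  refine hU.induction_insert h.acyclic ?_ fun U z hU hzU hz ih hsub hle => ?_
  · intro _ hle
    rwa [h.bot, sup_eq_right.2 hB] at hle
  · have hfan : insert z U ⊂ below e D x :=
      ⟨hsub.trans (strictBelow_subset_below x), fun hc => h.acyclic x (hsub (hc (mem_below x)))⟩
    have hgen : G (insert z U) ⊔ Q ⊓ G (below e D x) = G (below e D x) := by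
      rw [← sup_inf_assoc_of_le _ (h.mono hzU (isOpenIn_below hx) hfan.1)]
      exact inf_eq_right.2 hle
    refine ih ((Set.subset_insert z U).trans hsub) ?_
    -- A vertex `z` that is needed to generate together with `Q` would cleave the fan.
    by_contra hnot
    refine h.downward_fan x hx U (insert z U) hU hzU (Set.ssubset_insert hz) hfan
      (splits_sup_of_covBy (h.simple U z hU hzU hz) hgen fun hc => hnot ?_)
    exact (hgen.ge.trans (sup_le hc le_sup_right)).trans (sup_le_sup_left inf_le_left _)

theorem le_notAbove_of_inf_le [Finite V] (h : IsDiagramOf e D B A G) (hy : y ∈ D) (hA : Q ≤ A)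
    (hQ : Q ⊓ G (insert y (notAbove e D y)) ≤ G (notAbove e D y)) : Q ≤ G (notAbove e D y) := by
  suffices key : ∀ U, IsOpenIn e D U → insert y (notAbove e D y) ⊆ U →
      Q ⊓ G U ≤ G (notAbove e D y) → Q ≤ G (notAbove e D y) from
    key _ (isOpenIn_insert_notAbove h.acyclic hy) subset_rfl hQ
  intro U hU
  refine hU.induction_erase h.acyclic ?_ fun U z hU hzU hz ih hsub hle => ?_
  · intro _ hle
    rwa [h.top, inf_eq_left.2 hA] at hle
  · have hfan : notAbove e D y ⊂ U :=
      ⟨(Set.subset_insert _ _).trans hsub, fun hc => notMem_notAbove y (hc (hsub (Or.inl rfl)))⟩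
    have hcogen : G U ⊓ (G (notAbove e D y) ⊔ Q) = G (notAbove e D y) := by
      rw [inf_comm, sup_inf_assoc_of_le _ (h.mono (isOpenIn_notAbove y) hU hfan.1)]
      exact sup_eq_left.2 hle
    refine ih (hsub.trans (Set.subset_insert z U)) ?_
    by_contra hnot
    refine h.upward_fan y hy U (insert z U) hU hzU hfan (Set.ssubset_insert hz)
      (splits_inf_of_covBy (h.simple U z hU hzU hz) hcogen fun hc => hnot ?_)
    exact (le_inf ((le_inf inf_le_right (inf_le_left.trans le_sup_right)).trans hc)
      (inf_le_left.trans le_sup_right)).trans hcogen.le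

theorem le_of_forall_below_le [Finite V] (h : IsDiagramOf e D B A G) (hU : IsOpenIn e D U)
    (hB : B ≤ Q) (hQ : ∀ x ∈ U, G (below e D x) ≤ Q) : G U ≤ Q := by
  revert hQ
  refine hU.induction_insert h.acyclic (fun _ => h.bot.trans_le hB) ?_
  intro U x hU hxU _ ih hQ
  have hxo : IsOpenIn e D (below e D x) := isOpenIn_below (hxU.1 (Set.mem_insert x U))
  have hsub : insert x U ⊆ U ∪ below e D x :=
    Set.insert_subset (Or.inr (mem_below x)) Set.subset_union_left
  calc G (insert x U) ≤ G (U ∪ below e D x) := h.mono hxU (hU.union hxo) hsub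
    _ = G U ⊔ G (below e D x) := h.sup U _ hU hxo
    _ ≤ Q := sup_le (ih fun z hz => hQ z (Or.inr hz)) (hQ x (Or.inl rfl))

theorem le_of_forall_le_notAbove [Finite V] (h : IsDiagramOf e D B A G) (hU : IsOpenIn e D U)
    (hA : Q ≤ A) (hQ : ∀ y ∈ D \ U, Q ≤ G (notAbove e D y)) : Q ≤ G U := by
  revert hQ
  refine hU.induction_erase h.acyclic (fun _ => hA.trans_eq h.top.symm) ?_
  intro U y hU hyU hy ih hQ
  have hyo : IsOpenIn e D (notAbove e D y) := isOpenIn_notAbove y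
  have hsub : insert y U ∩ notAbove e D y ⊆ U := fun z hz =>
    hz.1.resolve_left fun hzy => notMem_notAbove y (hzy ▸ hz.2)
  calc Q ≤ G (insert y U) ⊓ G (notAbove e D y) :=
        le_inf (ih fun z hz => hQ z ⟨hz.1, fun hzU => hz.2 (Or.inr hzU)⟩)
          (hQ y ⟨hyU.1 (Set.mem_insert y U), hy⟩)
    _ = G (insert y U ∩ notAbove e D y) := (h.inf _ _ hyU hyo).symm
    _ ≤ G U := h.mono (hyU.inter hyo) hU hsub

theorem placedAt_insert (h : IsDiagramOf e D B A G) (hU : IsOpenIn e D U)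
    (hxU : IsOpenIn e D (insert x U)) (hx : x ∉ U) :
    PlacedAt e D G (G U) (G (insert x U)) x := by
  refine ⟨h.simple U x hU hxU hx, fun O hO => ?_⟩
  rw [← h.inf _ _ hxU hO]
  refine ⟨fun hxO => ?_, fun hxO => h.mono (hxU.inter hO) hU ?_⟩
  · rw [← h.sup _ _ hU (hxU.inter hO)]
    refine h.mono hxU (hU.union (hxU.inter hO)) (Set.insert_subset ?_ Set.subset_union_left)
    exact Or.inr ⟨Set.mem_insert x U, hxO⟩
  · exact fun z hz => hz.1.resolve_left fun hzx => hxO (hzx ▸ hz.2)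

end IsDiagramOf

namespace PlacedAt

theorem below_le [Finite V] (hp : PlacedAt e D G N T x) (h : IsDiagramOf e D B A G) (hx : x ∈ D)
    (hB : B ≤ T) : G (below e D x) ≤ T := by
  have hT := (hp.2 _ (isOpenIn_below hx)).1 (mem_below x)
  have hN := (hp.2 _ (isOpenIn_strictBelow x)).2 (h.acyclic x)
  have hnot : ¬ T ⊓ G (below e D x) ≤ G (strictBelow e D x) := fun hc =>
    hp.1.lt.not_ge (hT.trans (sup_le le_rfl ((le_inf inf_le_left hc).trans hN)))
  refine h.below_le_of_le_sup hx hB ?_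
  rw [← sup_eq_of_covBy_of_not_le (h.strictBelow_covBy hx) inf_le_right hnot]
  exact sup_le_sup_left inf_le_left _

theorem le_notAbove [Finite V] (hp : PlacedAt e D G N T y) (h : IsDiagramOf e D B A G) (hy : y ∈ D)
    (hA : N ≤ A) : N ≤ G (notAbove e D y) := by
  have hT := (hp.2 _ (isOpenIn_insert_notAbove h.acyclic hy)).1 (Set.mem_insert y _)
  have hN := (hp.2 _ (isOpenIn_notAbove y)).2 (notMem_notAbove y)
  have hnot : ¬ G (insert y (notAbove e D y)) ≤ N ⊔ G (notAbove e D y) := fun hc => by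
    refine hp.1.lt.not_ge (hT.trans (sup_le le_rfl ?_))
    calc T ⊓ G (insert y (notAbove e D y)) ≤ (N ⊔ G (notAbove e D y)) ⊓ T :=
          le_inf (inf_le_right.trans hc) inf_le_left
      _ = N ⊔ G (notAbove e D y) ⊓ T := sup_inf_assoc_of_le _ hp.1.le
      _ ≤ N := sup_le le_rfl (inf_comm T _ ▸ hN)
  refine h.le_notAbove_of_inf_le hy hA ?_
  rw [inf_comm, ← inf_eq_of_covBy_of_not_le (h.notAbove_covBy hy) le_sup_right hnot]
  exact inf_le_inf_left _ le_sup_left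

end PlacedAt

section Convex

variable {F : Set V → Submodule R M}

theorem PlacedAt.restrict (hF : IsDiagramOf e Set.univ B A F) (hD : IsConvex e D) (hx : x ∈ D)
    (hp : PlacedAt e Set.univ F N T x) :
    PlacedAt e D (fun U => F (openExtension e D U))
      (N ⊓ F (openExtension e D D) ⊔ F (openExtension e D ∅))
      (T ⊓ F (openExtension e D D) ⊔ F (openExtension e D ∅)) x := by
  have hself := hD.isOpenIn_openExtension (isOpenIn_self (e := e))
  have hempty := hD.isOpenIn_openExtension (isOpenIn_empty (e := e))
  refine ⟨inf_sup_covBy_inf_sup hp.1 ((hp.2 _ hself).1 ((mem_openExtension hx).2 hx))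
    ((hp.2 _ hempty).2 fun h => (mem_openExtension hx).1 h), fun U hU => ?_⟩
  have hUo := hD.isOpenIn_openExtension hU
  refine ⟨fun hxU => ?_, fun hxU => ?_⟩
  · exact inf_sup_le_of_le_sup_inf (hF.mono hUo hself (openExtension_mono hU.1))
      ((hp.2 _ hUo).1 ((mem_openExtension hx).2 hxU))
  · exact inf_sup_inf_le_of_inf_le (hF.mono hempty hUo (openExtension_mono (Set.empty_subset U)))
      ((hp.2 _ hUo).2 fun h => hxU ((mem_openExtension hx).1 h))

namespace IsDiagramOf

theorem not_transGen (h : IsDiagramOf e Set.univ B A F) (D : Set V) (x : V) :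
    ¬ Relation.TransGen (EdgeIn e D) x x :=
  fun hx => h.acyclic x (strictBelow_subset_strictBelow_univ x hx)

theorem openExtension_below_le [Finite V] (h : IsDiagramOf e Set.univ B A F) (hD : IsConvex e D)
    (hx : x ∈ D) (hQ : F (openExtension e D ∅) ≤ Q)
    (hle : F (openExtension e D (below e D x)) ≤ F (openExtension e D (strictBelow e D x)) ⊔ Q) :
    F (openExtension e D (below e D x)) ≤ Q := by
  have hempty := hD.isOpenIn_openExtension (isOpenIn_empty (e := e))
  have hxo : IsOpenIn e Set.univ (below e Set.univ x) := isOpenIn_below trivial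
  have hxo' : IsOpenIn e Set.univ (strictBelow e Set.univ x) := isOpenIn_strictBelow x
  have hstrict : F (openExtension e D (strictBelow e D x)) ≤ F (strictBelow e Set.univ x) ⊔ Q := by
    have hsub : openExtension e D (strictBelow e D x) ⊆
        strictBelow e Set.univ x ∪ openExtension e D ∅ :=
      Set.union_subset_union (strictBelow_subset_strictBelow_univ x) Set.subset_union_right
    refine (h.mono (hD.isOpenIn_openExtension (isOpenIn_strictBelow x)) (hxo'.union hempty)
      hsub).trans ?_
    rw [h.sup _ _ hxo' hempty]
    exact sup_le_sup_left hQ _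
  rw [hD.openExtension_below hx, h.sup _ _ hxo hempty] at hle ⊢
  refine sup_le (h.below_le_of_le_sup trivial ((h.lower_le hempty).trans hQ) ?_) hQ
  exact (le_sup_left.trans hle).trans (sup_le hstrict le_sup_right)

theorem le_openExtension_notAbove [Finite V] (h : IsDiagramOf e Set.univ B A F)
    (hD : IsConvex e D) (hy : y ∈ D) (hQ : Q ≤ F (openExtension e D D))
    (hle : Q ⊓ F (openExtension e D (insert y (notAbove e D y))) ≤
      F (openExtension e D (notAbove e D y))) :
    Q ≤ F (openExtension e D (notAbove e D y)) := by
  have hself := hD.isOpenIn_openExtension (isOpenIn_self (e := e))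
  have hyo : IsOpenIn e Set.univ (notAbove e Set.univ y) := isOpenIn_notAbove y
  have hyo' : IsOpenIn e Set.univ (insert y (notAbove e Set.univ y)) :=
    isOpenIn_insert_notAbove h.acyclic trivial
  have hins : insert y (notAbove e Set.univ y) ∩ openExtension e D D =
      openExtension e D (insert y (notAbove e D y)) := by
    rw [openExtension_insert, hD.openExtension_notAbove hy,
      Set.insert_inter_of_mem ((mem_openExtension hy).2 hy)]
  rw [← hins, hD.openExtension_notAbove hy, h.inf _ _ hyo hself, h.inf _ _ hyo' hself] at hle
  rw [hD.openExtension_notAbove hy, h.inf _ _ hyo hself]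
  refine le_inf (h.le_notAbove_of_inf_le trivial (hQ.trans (h.le_upper hself)) ?_) hQ
  exact (le_inf inf_le_left (le_inf inf_le_right (inf_le_left.trans hQ))).trans
    (hle.trans inf_le_left)

theorem not_splits_openExtension_below [Finite V] (h : IsDiagramOf e Set.univ B A F)
    (hD : IsConvex e D) (hx : x ∈ D) (h₁ : IsOpenIn e D U) (h₂ : IsOpenIn e D W) (h₁₂ : U ⊂ W)
    (h₂x : W ⊂ below e D x) :
    ¬ Splits (F (openExtension e D U)) (F (openExtension e D W))
      (F (openExtension e D (below e D x))) := by
  rintro ⟨K, hK₁, hK₂⟩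
  have h₁o := hD.isOpenIn_openExtension h₁
  have h₂o := hD.isOpenIn_openExtension h₂
  have hempty := hD.isOpenIn_openExtension (isOpenIn_empty (e := e))
  have hWx := h.mono h₂o (hD.isOpenIn_openExtension (isOpenIn_strictBelow x))
    (openExtension_mono (h₂.subset_strictBelow h₂x))
  have hxK : F (openExtension e D (below e D x)) ≤ K := by
    refine h.openExtension_below_le hD hx ?_ (hK₁.ge.trans (sup_le_sup_right hWx K))
    exact (h.mono hempty h₁o (openExtension_mono (Set.empty_subset _))).trans
      (hK₂.ge.trans inf_le_right)
  have hle : F (openExtension e D W) ≤ F (openExtension e D U) :=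
    (le_inf le_rfl ((le_sup_left.trans hK₁.le).trans hxK)).trans hK₂.le
  exact h₁₂.2 (subset_of_openExtension_subset h₂.1 (h.subset_of_le h₂o h₁o hle))

theorem not_splits_openExtension_notAbove [Finite V] (h : IsDiagramOf e Set.univ B A F)
    (hD : IsConvex e D) (hy : y ∈ D) (h₁ : IsOpenIn e D U) (h₂ : IsOpenIn e D W)
    (hy₁ : notAbove e D y ⊂ U) (h₁₂ : U ⊂ W) :
    ¬ Splits (F (openExtension e D (notAbove e D y))) (F (openExtension e D U))
      (F (openExtension e D W)) := by
  rintro ⟨K, hK₁, hK₂⟩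
  have h₁o := hD.isOpenIn_openExtension h₁
  have h₂o := hD.isOpenIn_openExtension h₂
  have hself := hD.isOpenIn_openExtension (isOpenIn_self (e := e))
  have hyo : IsOpenIn e D (insert y (notAbove e D y)) :=
    isOpenIn_insert_notAbove (h.not_transGen D) hy
  have hyU := h.mono (hD.isOpenIn_openExtension hyo) h₁o
    (openExtension_mono (Set.insert_subset (h₁.mem_of_notAbove_ssubset hy₁) hy₁.1))
  have hKy : K ≤ F (openExtension e D (notAbove e D y)) := by
    refine h.le_openExtension_notAbove hD hy ?_
      ((le_inf (inf_le_right.trans hyU) inf_le_left).trans hK₂.le)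
    exact (le_sup_right.trans hK₁.le).trans (h.mono h₂o hself (openExtension_mono h₂.1))
  have hle : F (openExtension e D W) ≤ F (openExtension e D U) :=
    hK₁.ge.trans (sup_le le_rfl (hKy.trans (hK₂.ge.trans inf_le_left)))
  exact h₁₂.2 (subset_of_openExtension_subset h₂.1 (h.subset_of_le h₂o h₁o hle))

theorem restrict [Finite V] (h : IsDiagramOf e Set.univ B A F) (hD : IsConvex e D) :
    IsDiagramOf e D (F (openExtension e D ∅)) (F (openExtension e D D))
      (fun U => F (openExtension e D U)) where
  acyclic := h.not_transGen D
  bot := rfl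
  top := rfl
  sup U W hU hW := by
    rw [← h.sup _ _ (hD.isOpenIn_openExtension hU) (hD.isOpenIn_openExtension hW)]
    exact congrArg F (Set.union_union_distrib_right _ _ _)
  inf U W hU hW := by
    rw [← h.inf _ _ (hD.isOpenIn_openExtension hU) (hD.isOpenIn_openExtension hW)]
    exact congrArg F (Set.inter_union_distrib_right _ _ _)
  simple U x hU hxU hx := by
    have hxUo := hD.isOpenIn_openExtension hxU
    rw [openExtension_insert] at hxUo ⊢
    exact h.simple _ x (hD.isOpenIn_openExtension hU) hxUo
      fun hc => hx ((mem_openExtension (hxU.1 (Set.mem_insert x U))).1 hc)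
  downward_fan _ hx _ _ := h.not_splits_openExtension_below hD hx
  upward_fan _ hy _ _ := h.not_splits_openExtension_notAbove hD hy
  edge x y hxy := by
    obtain ⟨P, N, T, -, -, hy, hx, hs⟩ := h.edge x y ⟨trivial, trivial, hxy.2.2⟩
    have hself := hD.isOpenIn_openExtension (isOpenIn_self (e := e))
    have hempty := hD.isOpenIn_openExtension (isOpenIn_empty (e := e))
    have hle := h.mono hempty hself (openExtension_mono (Set.empty_subset D))
    refine ⟨_, _, _, le_sup_right, sup_le inf_le_right hle, hy.restrict h hD hxy.2.1,
      hx.restrict h hD hxy.1, fun hsplit => hs (hsplit.of_inf_sup hy.1.le hx.1.le hle ?_ ?_)⟩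
    · exact (hx.2 _ hself).1 ((mem_openExtension hxy.1).2 hxy.1)
    · exact (hy.2 _ hempty).2 fun hc => (mem_openExtension hxy.2.1).1 hc

end IsDiagramOf

end Convex

section Realization

variable {F : Set V → Submodule R M} {A₀ B₀ : Submodule R M}

/-- The simple constituents at the vertices of the diagram `e`, `G` on `D` are placed at the same
vertices of the diagram `e`, `F` on all vertices: the condition under which the former realizes `D`
as a subdiagram of the latter. -/
def VerticesPlacedIn (e : V → V → Prop) (D : Set V) (G F : Set V → Submodule R M) : Prop :=
  ∀ U x, IsOpenIn e D U → IsOpenIn e D (insert x U) → x ∉ U →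
    PlacedAt e Set.univ F (G U) (G (insert x U)) x

theorem IsDiagramOf.verticesPlacedIn_openExtension (hF : IsDiagramOf e Set.univ B₀ A₀ F)
    (hD : IsConvex e D) : VerticesPlacedIn e D (fun U => F (openExtension e D U)) F := by
  intro U x hU hxU hx
  have hxUo := hD.isOpenIn_openExtension hxU
  simp only [openExtension_insert] at hxUo ⊢
  exact hF.placedAt_insert (hD.isOpenIn_openExtension hU) hxUo
    fun hc => hx ((mem_openExtension (hxU.1 (Set.mem_insert x U))).1 hc)

namespace VerticesPlacedIn

theorem placedAt_below (hp : VerticesPlacedIn e D G F) (hG : IsDiagramOf e D B A G) (hx : x ∈ D) :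
    PlacedAt e Set.univ F (G (strictBelow e D x)) (G (below e D x)) x := by
  rw [← insert_strictBelow]
  refine hp _ x (isOpenIn_strictBelow x) ?_ (hG.acyclic x)
  rw [insert_strictBelow]
  exact isOpenIn_below hx

theorem placedAt_notAbove (hp : VerticesPlacedIn e D G F) (hG : IsDiagramOf e D B A G)
    (hy : y ∈ D) :
    PlacedAt e Set.univ F (G (notAbove e D y)) (G (insert y (notAbove e D y))) y :=
  hp _ y (isOpenIn_notAbove y) (isOpenIn_insert_notAbove hG.acyclic hy) (notMem_notAbove y)

variable [Finite V]

theorem below_le_upper (hp : VerticesPlacedIn e D G F) (hG : IsDiagramOf e D B A G)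
    (hF : IsDiagramOf e Set.univ B₀ A₀ F) (hB : B₀ ≤ B) (hx : x ∈ D) :
    F (below e Set.univ x) ≤ A :=
  have hxo : IsOpenIn e D (below e D x) := isOpenIn_below hx
  ((hp.placedAt_below hG hx).below_le hF trivial (hB.trans (hG.lower_le hxo))).trans
    (hG.le_upper hxo)

theorem lower_le_notAbove (hp : VerticesPlacedIn e D G F) (hG : IsDiagramOf e D B A G)
    (hF : IsDiagramOf e Set.univ B₀ A₀ F) (hA : A ≤ A₀) (hy : y ∈ D) :
    B ≤ F (notAbove e Set.univ y) :=
  have hyo : IsOpenIn e D (notAbove e D y) := isOpenIn_notAbove y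
  (hG.lower_le hyo).trans
    ((hp.placedAt_notAbove hG hy).le_notAbove hF trivial ((hG.le_upper hyo).trans hA))

theorem below_le_sup_below (hp : VerticesPlacedIn e D G F) (hG : IsDiagramOf e D B A G)
    (hx : x ∈ D) : G (below e D x) ≤ B ⊔ F (below e Set.univ x) := by
  have hT := ((hp.placedAt_below hG hx).2 _ (isOpenIn_below trivial)).1 (mem_below x)
  refine hG.below_le_of_le_sup hx le_sup_left (hT.trans (sup_le_sup_left ?_ _))
  exact inf_le_right.trans le_sup_right

theorem inf_notAbove_le_notAbove (hp : VerticesPlacedIn e D G F) (hG : IsDiagramOf e D B A G)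
    (hy : y ∈ D) : A ⊓ F (notAbove e Set.univ y) ≤ G (notAbove e D y) := by
  have hN := ((hp.placedAt_notAbove hG hy).2 _ (isOpenIn_notAbove y)).2 (notMem_notAbove y)
  refine hG.le_notAbove_of_inf_le hy inf_le_left (le_trans (le_inf inf_le_right ?_) hN)
  exact inf_le_left.trans inf_le_right

theorem inter_le_sup (hp : VerticesPlacedIn e D G F) (hG : IsDiagramOf e D B A G)
    (hF : IsDiagramOf e Set.univ B₀ A₀ F) (hU : IsOpenIn e Set.univ U) : G (D ∩ U) ≤ B ⊔ F U :=
  hG.le_of_forall_below_le (hU.inter_of_univ D) le_sup_left fun _ hx =>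
    (hp.below_le_sup_below hG hx.1).trans
      (sup_le_sup_left (hF.mono (isOpenIn_below trivial) hU (hU.below_subset hx.2)) B)

theorem inf_le_inter (hp : VerticesPlacedIn e D G F) (hG : IsDiagramOf e D B A G)
    (hF : IsDiagramOf e Set.univ B₀ A₀ F) (hU : IsOpenIn e Set.univ U) : A ⊓ F U ≤ G (D ∩ U) :=
  hG.le_of_forall_le_notAbove (hU.inter_of_univ D) inf_le_left fun y hy =>
    have hyU : U ⊆ notAbove e Set.univ y := hU.subset_notAbove fun hc => hy.2 ⟨hy.1, hc⟩
    (inf_le_inf_left A (hF.mono hU (isOpenIn_notAbove y) hyU)).trans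
      (hp.inf_notAbove_le_notAbove hG hy.1)

theorem isConvex (hp : VerticesPlacedIn e D G F) (hG : IsDiagramOf e D B A G)
    (hF : IsDiagramOf e Set.univ B₀ A₀ F) (hB : B₀ ≤ B) (hA : A ≤ A₀) : IsConvex e D := by
  intro x hx y hy z hxz hzy
  by_contra hz
  have hzo : IsOpenIn e Set.univ (below e Set.univ z) := isOpenIn_below trivial
  have hxo : IsOpenIn e Set.univ (below e Set.univ x) := isOpenIn_below trivial
  have hzA : F (below e Set.univ z) ≤ A :=
    (hF.mono hzo hxo (hxo.below_subset hxz)).trans (hp.below_le_upper hG hF hB hx)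
  have htrace : D ∩ below e Set.univ z = D ∩ strictBelow e Set.univ z :=
    Set.Subset.antisymm
      (fun v hv => ⟨hv.1, mem_strictBelow_of_mem_below hv.2 fun hvz => hz (hvz ▸ hv.1)⟩)
      (Set.inter_subset_inter_right D (strictBelow_subset_below z))
  have hgen : F (below e Set.univ z) ≤ F (strictBelow e Set.univ z) ⊔ B :=
    calc F (below e Set.univ z) ≤ A ⊓ F (below e Set.univ z) := le_inf hzA le_rfl
      _ ≤ G (D ∩ strictBelow e Set.univ z) := htrace ▸ hp.inf_le_inter hG hF hzo
      _ ≤ B ⊔ F (strictBelow e Set.univ z) := hp.inter_le_sup hG hF (isOpenIn_strictBelow z)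
      _ = F (strictBelow e Set.univ z) ⊔ B := sup_comm _ _
  have hzB : F (below e Set.univ z) ≤ B := hF.below_le_of_le_sup trivial hB hgen
  have hzy' : below e Set.univ z ⊆ notAbove e Set.univ y :=
    hF.subset_of_le hzo (isOpenIn_notAbove y) (hzB.trans (hp.lower_le_notAbove hG hF hA hy))
  exact (hzy' (mem_below z)).2 hzy

end VerticesPlacedIn

end Realization

section Radical

variable {i : ℕ}

theorem radPow_succ_le (i : ℕ) : radPow R M (i + 1) ≤ radPow R M i :=
  Submodule.map_subtype_le _ _

theorem radPow_antitone : Antitone (radPow R M) := antitone_nat_of_succ_le radPow_succ_le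

theorem le_radPow_succ_iff :
    N ≤ radPow R M (i + 1) ↔ N ≤ radPow R M i ∧ ∀ L, L ⋖ radPow R M i → N ≤ L := by
  have hcoatom (m : Submodule R (radPow R M i)) :
      IsCoatom m ↔ m.map (radPow R M i).subtype ⋖ radPow R M i := by
    rw [← (radPow R M i).mapIic.isCoatom_iff, Set.Iic.isCoatom_iff, Submodule.coe_mapIic_apply]
  have hmap {L : Submodule R M} (hL : L ≤ radPow R M i) :
      (L.comap (radPow R M i).subtype).map (radPow R M i).subtype = L := by
    rw [Submodule.map_comap_subtype, inf_eq_right.2 hL]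
  constructor
  · refine fun hN => ⟨hN.trans (radPow_succ_le i), fun L hL => hN.trans ?_⟩
    exact Submodule.map_le_iff_le_comap.2 (sInf_le ((hcoatom _).2 ((hmap hL.le).symm ▸ hL)))
  · rintro ⟨hNi, hN⟩
    rw [← hmap hNi]
    refine Submodule.map_mono (le_sInf fun m hm => ?_)
    have hNm := hN _ ((hcoatom m).1 hm)
    exact (Submodule.map_le_map_iff_of_injective (radPow R M i).injective_subtype _ _).1
      ((hmap hNi).trans_le hNm)

theorem radPow_succ_le_of_covBy (hNT : N ⋖ T) (hT : radPow R M i ≤ T) :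
    radPow R M (i + 1) ≤ N := by
  by_cases hN : radPow R M i ≤ N
  · exact (radPow_succ_le i).trans hN
  · have hcov : N ⊓ radPow R M i ⋖ radPow R M i := by
      rw [← sup_eq_of_covBy_of_not_le hNT hT hN] at hNT
      exact hNT.inf_of_sup_left
    exact ((le_radPow_succ_iff.1 le_rfl).2 _ hcov).trans inf_le_left

theorem le_radPow_succ (hNT : N ≤ T) (hT : T ≤ radPow R M i)
    (hs : ∀ K : Submodule R M, T ≤ N ⊔ K → T ≤ K) : N ≤ radPow R M (i + 1) := by
  refine le_radPow_succ_iff.2 ⟨hNT.trans hT, fun L hL => ?_⟩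
  by_contra hNL
  have hsup : L ⊔ N = radPow R M i := sup_eq_of_covBy_of_not_le hL (hNT.trans hT) hNL
  exact hNL (hNT.trans (hs L (hT.trans (sup_comm L N ▸ hsup.ge))))

theorem IsDiagramOf.exists_radPow_le [Finite V] (h : IsDiagramOf e D B ⊤ G) :
    ∃ n, radPow R M n ≤ B := by
  rw [← h.bot]
  refine isOpenIn_empty.induction_erase h.acyclic ⟨0, h.top.ge⟩ ?_
  rintro U x hU hxU hx ⟨n, hn⟩
  exact ⟨n + 1, radPow_succ_le_of_covBy (h.simple U x hU hxU hx) hn⟩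

end Radical

namespace VirtualDiagram

variable {𝔇 : VirtualDiagram R M V} {i m : ℕ} {K : Fin (m + 1) → Set V}

theorem IsGeneralizedPath.exists_mem (h : 𝔇.IsGeneralizedPath x y m K) (i : Fin (m + 1)) :
    ∃ z ∈ K i, z ∈ below 𝔇.edge Set.univ x ∧ y ∈ below 𝔇.edge Set.univ z := by
  obtain ⟨h0, hm, -, a, b, hab, hba⟩ := h
  have hstep (j : Fin m) : a j.succ ∈ below 𝔇.edge Set.univ (a j.castSucc) :=
    Relation.ReflTransGen.tail (below_subset_below_univ _ (hab j.castSucc).2.2)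
      ⟨trivial, trivial, hba j⟩
  obtain rfl : a 0 = x := h0.subset (hab 0).1
  obtain rfl : a (Fin.last m) = y := hm.subset (hab (Fin.last m)).1
  refine ⟨a i, (hab i).1, ?_, ?_⟩
  · induction i using Fin.induction with
    | zero => exact Relation.ReflTransGen.refl
    | succ j ih => exact Relation.ReflTransGen.trans ih (hstep j)
  · induction i using Fin.reverseInduction with
    | last => exact Relation.ReflTransGen.refl
    | cast j ih => exact Relation.ReflTransGen.trans (hstep j) ih

variable [Finite V]

theorem inRadicalLayer_of_le (hi : 𝔇.sub (below 𝔇.edge Set.univ x) ≤ radPow R M i)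
    (hi' : ¬ 𝔇.sub (below 𝔇.edge Set.univ x) ≤ radPow R M (i + 1)) :
    𝔇.InRadicalLayer x i := by
  have hcov := 𝔇.isDiagram.strictBelow_covBy (Set.mem_univ x)
  refine ⟨(le_inf le_rfl hi).trans le_sup_right, ?_⟩
  by_contra hnot
  refine hi' (𝔇.isDiagram.below_le_of_le_sup (Set.mem_univ x) bot_le ?_)
  rw [← sup_eq_of_covBy_of_not_le hcov inf_le_left hnot]
  exact sup_le_sup_left inf_le_right _

theorem exists_radicalLayer (𝔇 : VirtualDiagram R M V) (x : V) :
    ∃ i, 𝔇.sub (below 𝔇.edge Set.univ x) ≤ radPow R M i ∧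
      ¬ 𝔇.sub (below 𝔇.edge Set.univ x) ≤ radPow R M (i + 1) := by
  obtain ⟨n, hn⟩ := 𝔇.isDiagram.exists_radPow_le
  have hne : ¬ 𝔇.sub (below 𝔇.edge Set.univ x) ≤ radPow R M n := fun hx =>
    (𝔇.isDiagram.strictBelow_covBy (Set.mem_univ x)).lt.not_ge ((hx.trans hn).trans bot_le)
  simpa only [not_not] using Nat.exists_not_and_succ_of_not_zero_of_exists
    (p := fun k => ¬ 𝔇.sub (below 𝔇.edge Set.univ x) ≤ radPow R M k) (not_not.2 le_top) ⟨n, hne⟩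

theorem inDifferentLayers_of_mem_strictBelow (hy : y ∈ strictBelow 𝔇.edge Set.univ x) :
    𝔇.InDifferentLayers x y := by
  obtain ⟨i, hxi, hxi'⟩ := 𝔇.exists_radicalLayer x
  obtain ⟨j, hyj, hyj'⟩ := 𝔇.exists_radicalLayer y
  have hd := 𝔇.isDiagram
  have hxo : IsOpenIn 𝔇.edge Set.univ (strictBelow 𝔇.edge Set.univ x) := isOpenIn_strictBelow x
  have hyi : 𝔇.sub (below 𝔇.edge Set.univ y) ≤ radPow R M (i + 1) :=
    (hd.mono (isOpenIn_below trivial) hxo (hxo.below_subset hy)).trans <|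
      le_radPow_succ (hd.strictBelow_covBy trivial).le hxi fun _ =>
        hd.below_le_of_le_sup trivial bot_le
  have hij : i < j := by
    by_contra! hji
    exact hyj' (hyi.trans (radPow_antitone (Nat.succ_le_succ hji)))
  exact ⟨i, j, inRadicalLayer_of_le hxi hxi', inRadicalLayer_of_le hyj hyj', hij.ne⟩

theorem realizable_iff_isConvex : 𝔇.Realizable D ↔ IsConvex 𝔇.edge D := by
  have hF := 𝔇.isDiagram
  constructor
  · rintro ⟨B, A, -, G, hG, hp⟩
    exact VerticesPlacedIn.isConvex hp hG hF bot_le le_top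
  · intro hD
    have hG := hF.restrict hD
    exact ⟨_, _, hG.lower_le isOpenIn_self, _, hG, hF.verticesPlacedIn_openExtension hD⟩

theorem realizable_singleton (𝔇 : VirtualDiagram R M V) (x : V) : 𝔇.Realizable {x} := by
  refine realizable_iff_isConvex.2 ?_
  rintro _ rfl y rfl z hyz hzy
  by_contra hne
  exact 𝔇.isDiagram.acyclic y ((mem_strictBelow_of_mem_below hyz hne).trans_left hzy)

namespace IsGeneralizedPath

theorem singleton (𝔇 : VirtualDiagram R M V) (x : V) :
    𝔇.IsGeneralizedPath x x 0 fun _ => {x} :=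
  ⟨rfl, rfl, fun _ => 𝔇.realizable_singleton x, fun _ => x, fun _ => x,
    fun _ => ⟨rfl, rfl, Relation.ReflTransGen.refl⟩, fun i => i.elim0⟩

theorem cons (h : 𝔇.IsGeneralizedPath x y m K) (hz : 𝔇.edge z x) :
    𝔇.IsGeneralizedPath z y (m + 1) (Fin.cons {z} K) := by
  obtain ⟨h0, hm, hK, a, b, hab, hba⟩ := h
  obtain rfl : a 0 = x := h0.subset (hab 0).1
  refine ⟨rfl, by rwa [← Fin.succ_last], ?_, Fin.cons z a, Fin.cons z b, ?_, ?_⟩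
  · exact Fin.cases (𝔇.realizable_singleton z) hK
  · exact Fin.cases ⟨rfl, rfl, Relation.ReflTransGen.refl⟩ hab
  · exact Fin.cases hz hba

end IsGeneralizedPath

theorem exists_isGeneralizedPath (hxz : z ∈ below 𝔇.edge Set.univ x)
    (hzy : y ∈ below 𝔇.edge Set.univ z) :
    ∃ (m : ℕ) (K : Fin (m + 1) → Set V), 𝔇.IsGeneralizedPath x y m K ∧ ∃ i, K i = {z} := by
  induction hxz using Relation.ReflTransGen.head_induction_on with
  | refl =>
    induction hzy using Relation.ReflTransGen.head_induction_on with
    | refl => exact ⟨0, _, IsGeneralizedPath.singleton 𝔇 y, 0, rfl⟩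
    | head hzw _ ih =>
      obtain ⟨m, K, hK, -⟩ := ih
      exact ⟨m + 1, _, hK.cons hzw.2.2, 0, rfl⟩
  | head hxw _ ih =>
    obtain ⟨m, K, hK, i, hi⟩ := ih
    exact ⟨m + 1, _, hK.cons hxw.2.2, i.succ, hi⟩

end VirtualDiagram

end Diagram

end VirtualDiagrams

open VirtualDiagrams VirtualDiagram in
theorem mainTheorem4_general {R : Type*} [Ring R] {M : Type*} [AddCommGroup M] [Module R M]
    {V : Type*} [Finite V] (𝔇 : VirtualDiagram R M V) (D : Set V) :
    𝔇.Realizable D ↔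
      ¬ ∃ x ∈ D, ∃ y ∈ D, 𝔇.InDifferentLayers x y ∧
        ∃ (m : ℕ) (K : Fin (m + 1) → Set V),
          𝔇.IsGeneralizedPath x y m K ∧ ∃ i, Disjoint (K i) D := by
  rw [realizable_iff_isConvex]
  constructor
  · rintro hconvex ⟨x, hx, y, hy, -, m, K, hK, i, hi⟩
    obtain ⟨z, hzK, hxz, hzy⟩ := hK.exists_mem i
    exact Set.disjoint_left.1 hi hzK (hconvex hx hy hxz hzy)
  · intro hpath x hx y hy z hxz hzy
    by_contra hz
    have hxy : y ∈ strictBelow 𝔇.edge Set.univ x :=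
      (mem_strictBelow_of_mem_below hxz fun hzx => hz (hzx ▸ hx)).trans_left hzy
    obtain ⟨m, K, hK, i, hi⟩ := exists_isGeneralizedPath hxz hzy
    have hdisj : Disjoint (K i) D := hi ▸ Set.disjoint_singleton_left.2 hz
    exact hpath ⟨x, hx, y, hy, inDifferentLayers_of_mem_strictBelow hxy, m, K, hK, i, hdisj⟩

theorem mainTheorem4 {R : Type*} [Ring R] {M : Type*} [AddCommGroup M] [Module R M]
    [IsNoetherian R M] [IsArtinian R M] {V : Type*} [Finite V]
    (𝔇 : VirtualDiagrams.VirtualDiagram R M V) (D : Set V)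
    (hD : VirtualDiagrams.IsConnectedSubdiagram 𝔇.edge D) :
    𝔇.Realizable D ↔
      ¬ ∃ x ∈ D, ∃ y ∈ D, 𝔇.InDifferentLayers x y ∧
        ∃ (m : ℕ) (K : Fin (m + 1) → Set V),
          𝔇.IsGeneralizedPath x y m K ∧ ∃ i, Disjoint (K i) D :=
  mainTheorem4_general 𝔇 D
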